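/- Let $SL_2=\{F\in\mathbb R^{2\times 2}:\det F=1\}$ and let $\Omega\subset\mathbb R^2$ be a non-empty bounded open set. Let $[SL_2](\Omega)$ be the set of all $\phi\in C^\infty(\mathbb R^2,\mathbb R^2)$ with $\nabla\phi(x)\in SL_2$ for every $x\in\mathbb R^2$ and such that the support of $\phi-\mathrm{id}$ is a compact subset of $\Omega$; write $[SL_2]_c=[SL_2](\mathbb R^2)$, and let $J_c(SL_2)=\{\nabla\phi(x_0):\phi\in[SL_2]_c,\ x_0\in\mathbb R^2\}$, which is all of $SL_2$. A homogeneous $SL_2$ null lagrangian is a $C^\infty$ function $W$ on $J_c(SL_2)=SL_2$ such that $$\int_\Omega W(\nabla\phi(x))\,dx$$ has the same value for all $\phi\in[SL_2](\Omega)$. Theorem. If $W$ is a homogeneous $SL_2$ null lagrangian, then $W$ is affine: there are real constants $a_{ij}$ ($i,j\in\{1,2\}$) and $b$ such that $$W(F)=\sum_{i,j=1}^{2}a_{ij}F_{ij}+b\qquad\text{for all }F\in SL_2 .$$ -/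

import Mathlib

open MeasureTheory Set
open scoped ContDiff

namespace DiffeoGroup

section

open scoped Matrix.Norms.Elementwise Topology

/-- `GL_n`: invertible real matrices with positive determinant. -/
abbrev GLp (n : ℕ) : Type := Matrix.GLPos (Fin n) ℝ

/-- The set of matrices underlying a subgroup `M` of `GL_n`. -/
def carrier {n : ℕ} (M : Subgroup (GLp n)) : Set (Matrix (Fin n) (Fin n) ℝ) :=
  {A | ∃ g ∈ M, ((g : GL (Fin n) ℝ) : Matrix (Fin n) (Fin n) ℝ) = A}

/-- The subgroup `SL_n` of `GL_n`. -/
noncomputable def SL (n : ℕ) : Subgroup (GLp n) :=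
  (Matrix.SpecialLinearGroup.toGLPos (n := Fin n) (R := ℝ)).range

theorem mem_carrier_SL {n : ℕ} (A : Matrix (Fin n) (Fin n) ℝ) :
    A ∈ carrier (SL n) ↔ A.det = 1 := by
  constructor
  · rintro ⟨g, ⟨s, rfl⟩, rfl⟩
    exact s.2
  · intro h
    exact ⟨_, ⟨⟨A, h⟩, rfl⟩, rfl⟩

/-- The Jacobian matrix `(∇φ(x))_{ij} = ∂φ_i/∂x_j (x)`. -/
noncomputable def grad {n : ℕ} (φ : (Fin n → ℝ) → (Fin n → ℝ)) (x : Fin n → ℝ) :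
    Matrix (Fin n) (Fin n) ℝ :=
  Matrix.of fun i j => fderiv ℝ φ x (Pi.single j 1) i

/-- The local group `[M]`: smooth maps of `ℝⁿ` whose Jacobian matrix lies in `M` everywhere. -/
def localGroup {n : ℕ} (M : Subgroup (GLp n)) : Set ((Fin n → ℝ) → (Fin n → ℝ)) :=
  {φ | ContDiff ℝ ∞ φ ∧ ∀ x, grad φ x ∈ carrier M}

/-- `[M](E)`: the elements `φ` of `[M]` for which the support of `φ - id` is a compact
subset of `E`. -/
def localGroupOn {n : ℕ} (M : Subgroup (GLp n)) (E : Set (Fin n → ℝ)) :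
    Set ((Fin n → ℝ) → (Fin n → ℝ)) :=
  {φ | φ ∈ localGroup M ∧ HasCompactSupport (fun x => φ x - x) ∧
    tsupport (fun x => φ x - x) ⊆ E}

/-- `[M]_c`: the elements of `[M]` that are the identity off a compact set. -/
def localGroupC {n : ℕ} (M : Subgroup (GLp n)) : Set ((Fin n → ℝ) → (Fin n → ℝ)) :=
  localGroupOn M univ

/-- `J_c(M)`: the values `∇φ(x₀)` for `φ ∈ [M]_c`. Conjugating by translations shows that every
point `x₀` gives the same set of values. -/
def jetC {n : ℕ} (M : Subgroup (GLp n)) : Set (Matrix (Fin n) (Fin n) ℝ) :=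
  {A | ∃ φ ∈ localGroupC M, ∃ x₀, grad φ x₀ = A}

/-- Smoothness of a real function on a subset `S` of a normed space: near each point of `S` it
is the restriction of a smooth function defined on an open set. On an embedded submanifold this
is smoothness in the sense of manifolds. -/
def SmoothOnSubset {X : Type*} [NormedAddCommGroup X] [NormedSpace ℝ X]
    (f : X → ℝ) (S : Set X) : Prop :=
  ∀ p ∈ S, ∃ U : Set X, IsOpen U ∧ p ∈ U ∧
    ∃ g : X → ℝ, ContDiffOn ℝ ∞ g U ∧ EqOn f g (U ∩ S)

/-- `Λ⁰(M) = C^∞(ℝⁿ × J_c(M))`. Functions of `(y, F)` are total here, but only their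
values at matrices `F ∈ J_c(M)` matter. -/
def Lambda0 {n : ℕ} (M : Subgroup (GLp n)) :
    Set ((Fin n → ℝ) → Matrix (Fin n) (Fin n) ℝ → ℝ) :=
  {W | SmoothOnSubset (fun p : (Fin n → ℝ) × Matrix (Fin n) (Fin n) ℝ => W p.1 p.2)
    (univ ×ˢ jetC M)}

/-- `I_W(φ; Ω) = ∫_Ω W(φ(x), ∇φ(x)) dx`. -/
noncomputable def integralI {n : ℕ} (W : (Fin n → ℝ) → Matrix (Fin n) (Fin n) ℝ → ℝ)
    (Ω : Set (Fin n → ℝ)) (φ : (Fin n → ℝ) → (Fin n → ℝ)) : ℝ :=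
  ∫ x in Ω, W (φ x) (grad φ x)

/-- The group of affine homothety-translations `x ↦ x₁ + ε (x - x₀)` with `ε > 0`. -/
def homothetyTranslations (n : ℕ) : Set ((Fin n → ℝ) → (Fin n → ℝ)) :=
  {f | ∃ (x₀ x₁ : Fin n → ℝ) (ε : ℝ), 0 < ε ∧ f = fun x => x₁ + ε • (x - x₀)}

/-- `M` null lagrangians, with respect to the domain `Ω`: the `W ∈ Λ⁰(M)` such that, for every
homothety-translation `f`, the integral `I_{(W,f)}` with `(W,f)(y,F) = W(f(y),F)` is constant
over `[M](Ω)`. -/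
def NullLagrangian {n : ℕ} (M : Subgroup (GLp n)) (Ω : Set (Fin n → ℝ)) :
    Set ((Fin n → ℝ) → Matrix (Fin n) (Fin n) ℝ → ℝ) :=
  {W | W ∈ Lambda0 M ∧ ∀ f ∈ homothetyTranslations n, ∃ c : ℝ,
    ∀ φ ∈ localGroupOn M Ω, integralI (fun y F => W (f y) F) Ω φ = c}

/-- Homogeneous `M` null lagrangians `nl⁰(M)`: those that depend on the matrix variable only. -/
def HomNullLagrangian {n : ℕ} (M : Subgroup (GLp n)) (Ω : Set (Fin n → ℝ)) :
    Set (Matrix (Fin n) (Fin n) ℝ → ℝ) :=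
  {W | (fun _ F => W F) ∈ NullLagrangian M Ω}

end

end DiffeoGroup

/-!
A null function `W` integrates to the same value over all the gradients of area-preserving
deformations. Two operations preserve this property: conjugation `G ↦ W (A G A⁻¹)`, by a linear
change of variables, and left translation `G ↦ W (F G)` (`IsNull.mul_left`), by composing a small
copy of a deformation with an area-preserving map that is linear with matrix `F` near a point. Such
a map exists for every `F ∈ SL₂` (`mem_linearGerms`): the admissible matrices are closed under
products and under conjugation, they contain the quarter turn (rotate rigidly near the origin and
twist back further out), and these closure properties generate `SL₂` from it.

Apply nullity to twists `x ↦ R(κ² h(|x|²)) x`, where `R(θ)` is the rotation by `θ`, conjugated by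
`diag(κ⁻¹, κ)`. They are explicit, and as `κ → 0` their Jacobian matrices converge uniformly to the
shears with coefficient `m(x) = ∂₂(-h(|x|²) x₂)`. So the mean of `W` over these shears is its value
at the identity (`IsNull.integral_shear`). By the two invariances, along every line
`t ↦ P (1 + t e₁ ⊗ e₂) Q` in `SL₂`, the function `u(t)` given by `W` satisfies
`∫ (u(t + s m(x)) - u(t)) dx = 0` for all `t` and `s`. As `m` has mean zero and is not zero, a
maximum principle forces the continuous function `u` to be affine
(`exists_affine_of_integral_comp_eq_zero`).

Finally, a function on `SL₂` that is affine on all these lines is affine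
(`exists_affine_of_affine_on_lines`): in the coordinates
`(x, y, z) ↦ U(x) L(y) U(z)`, where `U` and `L` are the upper and lower unipotent matrices, it is
affine in each variable separately. Of the eight coefficients, those that do not come from an affine
function of the matrix entries are excluded, first by comparing along `y = 0`, where only `x + z`
matters, and then by the line through `diag(2, 1/2)`, along which `(a - 1) (d - 1) / c` is not
affine.
-/

namespace DiffeoGroup

open Filter Topology Matrix

/-! ### Jacobian matrices and operations on `[SL_n]` -/

theorem grad_eq_toMatrix' {n : ℕ} (φ : (Fin n → ℝ) → (Fin n → ℝ)) (x : Fin n → ℝ) :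
    grad φ x = LinearMap.toMatrix' (fderiv ℝ φ x : (Fin n → ℝ) →ₗ[ℝ] (Fin n → ℝ)) := by
  ext i j
  simp [grad, LinearMap.toMatrix'_apply]

theorem grad_comp {n : ℕ} {φ ψ : (Fin n → ℝ) → (Fin n → ℝ)} {x : Fin n → ℝ}
    (hφ : DifferentiableAt ℝ φ (ψ x)) (hψ : DifferentiableAt ℝ ψ x) :
    grad (fun y => φ (ψ y)) x = grad φ (ψ x) * grad ψ x := by
  rw [grad_eq_toMatrix', grad_eq_toMatrix', grad_eq_toMatrix', ← LinearMap.toMatrix'_comp,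
    fderiv_fun_comp x hφ hψ]
  rfl

theorem grad_congr {n : ℕ} {φ ψ : (Fin n → ℝ) → (Fin n → ℝ)} {x : Fin n → ℝ}
    (h : φ =ᶠ[𝓝 x] ψ) : grad φ x = grad ψ x := by
  rw [grad_eq_toMatrix', grad_eq_toMatrix', h.fderiv_eq]

theorem grad_mulVec {n : ℕ} (A : Matrix (Fin n) (Fin n) ℝ) (x : Fin n → ℝ) :
    grad (fun y => A *ᵥ y) x = A := by
  have h : (fun y => A *ᵥ y) = (Matrix.toLin' A).toContinuousLinearMap := by ext; simp
  rw [grad_eq_toMatrix', h, ContinuousLinearMap.fderiv]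
  simp

theorem grad_id {n : ℕ} (x : Fin n → ℝ) : grad (fun y : Fin n → ℝ => y) x = 1 := by
  simpa using grad_mulVec (1 : Matrix (Fin n) (Fin n) ℝ) x

theorem contDiff_mulVec {n : ℕ} (A : Matrix (Fin n) (Fin n) ℝ) :
    ContDiff ℝ ∞ (fun y : Fin n → ℝ => A *ᵥ y) :=
  (Matrix.toLin' A).toContinuousLinearMap.contDiff

theorem continuous_grad {n : ℕ} {φ : (Fin n → ℝ) → (Fin n → ℝ)} (hφ : ContDiff ℝ ∞ φ) :
    Continuous (grad φ) := by
  refine continuous_matrix fun i j => ?_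
  have h : Continuous fun x => fderiv ℝ φ x := hφ.continuous_fderiv (by simp)
  exact (continuous_apply i).comp (h.clm_apply continuous_const)

/-- Membership in `[SL_n](E)` in terms of determinants and of a compact set outside which the
map is the identity. -/
theorem mem_localGroupOn_SL {n : ℕ} {E : Set (Fin n → ℝ)} {φ : (Fin n → ℝ) → (Fin n → ℝ)} :
    φ ∈ localGroupOn (SL n) E ↔ ContDiff ℝ ∞ φ ∧ (∀ x, (grad φ x).det = 1) ∧
      ∃ K, IsCompact K ∧ K ⊆ E ∧ ∀ x ∉ K, φ x = x := by
  constructor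
  · rintro ⟨⟨h1, h2⟩, h3, h4⟩
    refine ⟨h1, fun x => (mem_carrier_SL _).1 (h2 x), _, h3, h4, fun x hx => ?_⟩
    exact sub_eq_zero.1 (image_eq_zero_of_notMem_tsupport (f := fun x => φ x - x) hx)
  · rintro ⟨h1, h2, K, hK, hKE, h⟩
    have hs : tsupport (fun x => φ x - x) ⊆ K := by
      refine closure_minimal (fun x hx => ?_) hK.isClosed
      by_contra hxK
      exact hx (sub_eq_zero.2 (h x hxK))
    exact ⟨⟨h1, fun x => (mem_carrier_SL _).2 (h2 x)⟩,
      hK.of_isClosed_subset (isClosed_tsupport _) hs, hs.trans hKE⟩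

theorem mem_localGroupC_SL {n : ℕ} {φ : (Fin n → ℝ) → (Fin n → ℝ)} :
    φ ∈ localGroupC (SL n) ↔ ContDiff ℝ ∞ φ ∧ (∀ x, (grad φ x).det = 1) ∧
      ∃ K, IsCompact K ∧ ∀ x ∉ K, φ x = x := by
  simp [localGroupC, mem_localGroupOn_SL]

theorem grad_eq_one_of_notMem {n : ℕ} {φ : (Fin n → ℝ) → (Fin n → ℝ)} {K : Set (Fin n → ℝ)}
    (hK : IsCompact K) (h : ∀ x ∉ K, φ x = x) {x : Fin n → ℝ} (hx : x ∉ K) : grad φ x = 1 := by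
  rw [← grad_id x]
  refine grad_congr ?_
  filter_upwards [hK.isClosed.isOpen_compl.mem_nhds hx] with y hy using h y hy

theorem id_mem_localGroupOn {n : ℕ} (E : Set (Fin n → ℝ)) :
    (fun x => x) ∈ localGroupOn (SL n) E :=
  mem_localGroupOn_SL.2 ⟨contDiff_id, fun x => by rw [grad_id, det_one],
    ∅, isCompact_empty, empty_subset _, fun _ _ => rfl⟩

theorem comp_mem_localGroupC {n : ℕ} {φ ψ : (Fin n → ℝ) → (Fin n → ℝ)}
    (hφ : φ ∈ localGroupC (SL n)) (hψ : ψ ∈ localGroupC (SL n)) :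
    (fun x => φ (ψ x)) ∈ localGroupC (SL n) := by
  obtain ⟨h1, h2, K, hK, h3⟩ := mem_localGroupC_SL.1 hφ
  obtain ⟨k1, k2, L, hL, k3⟩ := mem_localGroupC_SL.1 hψ
  refine mem_localGroupC_SL.2 ⟨h1.comp k1, fun x => ?_, K ∪ L, hK.union hL, fun x hx => ?_⟩
  · rw [grad_comp (h1.differentiable (by simp) _) (k1.differentiable (by simp) _), det_mul, h2, k2,
      one_mul]
  · rw [mem_union, not_or] at hx
    rw [k3 x hx.2, h3 x hx.1]

theorem grad_conj {n : ℕ} {φ : (Fin n → ℝ) → (Fin n → ℝ)} (hφ : ContDiff ℝ ∞ φ)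
    (A B : Matrix (Fin n) (Fin n) ℝ) (x : Fin n → ℝ) :
    grad (fun y => A *ᵥ φ (B *ᵥ y)) x = A * grad φ (B *ᵥ x) * B := by
  have h1 : Differentiable ℝ fun y : Fin n → ℝ => A *ᵥ y :=
    (contDiff_mulVec A).differentiable (by simp)
  have h2 : Differentiable ℝ fun y : Fin n → ℝ => B *ᵥ y :=
    (contDiff_mulVec B).differentiable (by simp)
  have h3 : Differentiable ℝ φ := hφ.differentiable (by simp)
  rw [grad_comp (φ := fun y => A *ᵥ y) (ψ := fun y => φ (B *ᵥ y)) (h1 _) (h3.comp h2 _),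
    grad_comp (h3 _) (h2 _), grad_mulVec, grad_mulVec, mul_assoc]

theorem conj_mem_localGroupC {n : ℕ} {φ : (Fin n → ℝ) → (Fin n → ℝ)}
    (hφ : φ ∈ localGroupC (SL n)) {A B : Matrix (Fin n) (Fin n) ℝ} (hAB : A * B = 1) :
    (fun x => A *ᵥ φ (B *ᵥ x)) ∈ localGroupC (SL n) := by
  obtain ⟨h1, h2, K, hK, h3⟩ := mem_localGroupC_SL.1 hφ
  have hBA : B * A = 1 := mul_eq_one_comm.1 hAB
  refine mem_localGroupC_SL.2 ⟨(contDiff_mulVec A).comp (h1.comp (contDiff_mulVec B)), fun x => ?_,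
    (fun x => A *ᵥ x) '' K, hK.image (contDiff_mulVec A).continuous, fun x hx => ?_⟩
  · rw [grad_conj h1, det_mul, det_mul, h2, mul_one, ← det_mul, hAB, det_one]
  · rw [h3 _ fun hK => hx ⟨_, hK, by simp [hAB]⟩]
    simp [hAB]

/-- The homothetic copy `x ↦ x₀ + ε φ((x - x₀)/ε)` of a map `φ`, centred at `x₀`. -/
noncomputable def rescale {n : ℕ} (x₀ : Fin n → ℝ) (ε : ℝ) (φ : (Fin n → ℝ) → (Fin n → ℝ)) :
    (Fin n → ℝ) → (Fin n → ℝ) :=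
  fun x => x₀ + ε • φ (ε⁻¹ • (x - x₀))

theorem contDiff_rescale {n : ℕ} (x₀ : Fin n → ℝ) (ε : ℝ) {φ : (Fin n → ℝ) → (Fin n → ℝ)}
    (hφ : ContDiff ℝ ∞ φ) : ContDiff ℝ ∞ (rescale x₀ ε φ) := by
  unfold rescale
  fun_prop

theorem grad_rescale {n : ℕ} (x₀ : Fin n → ℝ) {ε : ℝ} (hε : ε ≠ 0)
    {φ : (Fin n → ℝ) → (Fin n → ℝ)} (hφ : ContDiff ℝ ∞ φ) (x : Fin n → ℝ) :
    grad (rescale x₀ ε φ) x = grad φ (ε⁻¹ • (x - x₀)) := by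
  have hd : DifferentiableAt ℝ φ (ε⁻¹ • (x - x₀)) := hφ.differentiable (by simp) _
  have h2 : HasFDerivAt (fun y : Fin n → ℝ => ε⁻¹ • (y - x₀))
      (ε⁻¹ • ContinuousLinearMap.id ℝ (Fin n → ℝ)) x :=
    ((hasFDerivAt_id x).sub_const x₀).const_smul ε⁻¹
  have h := ((hd.hasFDerivAt.comp x h2).const_smul ε).const_add x₀
  have h' : fderiv ℝ (rescale x₀ ε φ) x = fderiv ℝ φ (ε⁻¹ • (x - x₀)) := by
    refine HasFDerivAt.fderiv (HasFDerivAt.congr_fderiv h ?_)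
    ext v : 1
    simp [smul_smul, hε]
  rw [grad_eq_toMatrix', grad_eq_toMatrix', h']

theorem rescale_mem_localGroupOn {n : ℕ} (x₀ : Fin n → ℝ) {ε : ℝ} (hε : ε ≠ 0)
    {φ : (Fin n → ℝ) → (Fin n → ℝ)} (hφ : φ ∈ localGroupC (SL n)) {K E : Set (Fin n → ℝ)}
    (hK : IsCompact K) (h : ∀ x ∉ K, φ x = x) (hKE : ∀ x ∈ K, x₀ + ε • x ∈ E) :
    rescale x₀ ε φ ∈ localGroupOn (SL n) E := by
  obtain ⟨h1, h2, -⟩ := mem_localGroupC_SL.1 hφ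
  refine mem_localGroupOn_SL.2 ⟨contDiff_rescale x₀ ε h1, fun x => ?_,
    (fun x => x₀ + ε • x) '' K, hK.image (by fun_prop), ?_, fun x hx => ?_⟩
  · rw [grad_rescale x₀ hε h1, h2]
  · rintro _ ⟨x, hx, rfl⟩
    exact hKE x hx
  · unfold rescale
    rw [h _ fun hK => hx ⟨_, hK, by simp [smul_smul, hε]⟩]
    simp [smul_smul, hε]

/-- Compact sets are shrunk into any prescribed ball. -/
theorem exists_pos_smul_norm_lt {n : ℕ} {K : Set (Fin n → ℝ)} (hK : IsCompact K) {δ : ℝ}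
    (hδ : 0 < δ) : ∃ ε : ℝ, 0 < ε ∧ ∀ x ∈ K, ‖ε • x‖ < δ := by
  obtain ⟨R, hR⟩ := hK.isBounded.exists_norm_le
  refine ⟨δ / (|R| + 1), by positivity, fun x hx => ?_⟩
  have h1 : ‖x‖ < |R| + 1 := by linarith [hR x hx, le_abs_self R]
  rw [norm_smul, Real.norm_of_nonneg (by positivity), div_mul_eq_mul_div,
    div_lt_iff₀ (by positivity)]
  exact mul_lt_mul_of_pos_left h1 hδ

/-! ### Twists of the plane -/

/-- The twist of the plane that rotates each circle `|x|² = r` by the angle `h r`. -/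
noncomputable def twist (h : ℝ → ℝ) (x : Fin 2 → ℝ) : Fin 2 → ℝ :=
  ![Real.cos (h (x 0 ^ 2 + x 1 ^ 2)) * x 0 - Real.sin (h (x 0 ^ 2 + x 1 ^ 2)) * x 1,
    Real.sin (h (x 0 ^ 2 + x 1 ^ 2)) * x 0 + Real.cos (h (x 0 ^ 2 + x 1 ^ 2)) * x 1]

/-- The Jacobian matrix at `(x, y)` of a twist whose angle function has value `κ² θ₀` and derivative
`κ² θ₀'` at `x² + y²`, conjugated by `diag(κ⁻¹, κ)`. Conjugation multiplies the upper right entry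
by `κ⁻²`; writing `κ⁻² sin(κ² θ₀)` as `θ₀ sinc(κ² θ₀)` extends the formula continuously to
`κ = 0`. -/
noncomputable def twistJacobian (κ θ₀ θ₀' x y : ℝ) : Matrix (Fin 2) (Fin 2) ℝ :=
  let S := Real.sin (κ ^ 2 * θ₀)
  let C := Real.cos (κ ^ 2 * θ₀)
  !![C - 2 * (κ ^ 2 * θ₀') * (S * x + C * y) * x,
      -(θ₀ * Real.sinc (κ ^ 2 * θ₀)) - 2 * θ₀' * (S * x + C * y) * y;
    κ ^ 2 * (S + 2 * (κ ^ 2 * θ₀') * (C * x - S * y) * x),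
      C + 2 * (κ ^ 2 * θ₀') * (C * x - S * y) * y]

theorem contDiff_twist {h : ℝ → ℝ} (hh : ContDiff ℝ ∞ h) : ContDiff ℝ ∞ (twist h) := by
  rw [contDiff_pi]
  intro i
  fin_cases i <;> simp only [twist] <;> simp <;> fun_prop

theorem mul_sinc (t : ℝ) : t * Real.sinc t = Real.sin t := by
  by_cases ht : t = 0
  · simp [ht]
  · rw [Real.sinc_of_ne_zero ht]; field_simp

theorem grad_twist {h : ℝ → ℝ} (hh : ContDiff ℝ ∞ h) (x : Fin 2 → ℝ) :
    grad (twist h) x =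
      twistJacobian 1 (h (x 0 ^ 2 + x 1 ^ 2)) (deriv h (x 0 ^ 2 + x 1 ^ 2)) (x 0) (x 1) := by
  have p : ∀ i : Fin 2, HasFDerivAt (fun x : Fin 2 → ℝ => x i)
      (ContinuousLinearMap.proj (R := ℝ) (φ := fun _ : Fin 2 => ℝ) i) x :=
    fun i => hasFDerivAt_apply i x
  have hr := ((p 0).pow 2).add ((p 1).pow 2)
  have hθ := ((hh.differentiable (by simp) (x 0 ^ 2 + x 1 ^ 2)).hasDerivAt).comp_hasFDerivAt x hr
  have h0 := ((hθ.cos).mul (p 0)).sub ((hθ.sin).mul (p 1))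
  have h1 := ((hθ.sin).mul (p 0)).add ((hθ.cos).mul (p 1))
  have hd : DifferentiableAt ℝ (twist h) x := (contDiff_twist hh).differentiable (by simp) x
  have e0 := (hasFDerivAt_pi'.1 hd.hasFDerivAt 0).unique h0
  have e1 := (hasFDerivAt_pi'.1 hd.hasFDerivAt 1).unique h1
  ext i j
  have f0 := DFunLike.congr_fun e0 (Pi.single j 1)
  have f1 := DFunLike.congr_fun e1 (Pi.single j 1)
  simp only [ContinuousLinearMap.comp_apply, ContinuousLinearMap.proj_apply] at f0 f1
  rw [grad, of_apply]
  fin_cases i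
  · rw [Fin.zero_eta, f0]
    fin_cases j <;> simp [twistJacobian, mul_sinc] <;> ring
  · rw [Fin.mk_one, f1]
    fin_cases j <;> simp [twistJacobian] <;> ring

theorem det_twistJacobian (κ θ₀ θ₀' x y : ℝ) : (twistJacobian κ θ₀ θ₀' x y).det = 1 := by
  have h := mul_sinc (κ ^ 2 * θ₀)
  have h1 := Real.sin_sq_add_cos_sq (κ ^ 2 * θ₀)
  simp only [twistJacobian, det_fin_two_of]
  generalize Real.sin (κ ^ 2 * θ₀) = S at *
  generalize Real.cos (κ ^ 2 * θ₀) = C at *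
  generalize Real.sinc (κ ^ 2 * θ₀) = T at *
  linear_combination (S + 2 * (κ ^ 2 * θ₀') * (C * x - S * y) * x) * h + h1

theorem continuous_twistJacobian :
    Continuous fun p : ℝ × ℝ × ℝ × ℝ × ℝ =>
      twistJacobian p.1 p.2.1 p.2.2.1 p.2.2.2.1 p.2.2.2.2 := by
  refine continuous_matrix fun i j => ?_
  fin_cases i <;> fin_cases j <;> simp [twistJacobian] <;> fun_prop

theorem twistJacobian_conj {κ : ℝ} (hκ : κ ≠ 0) (θ₀ θ₀' x y : ℝ) :
    !![κ⁻¹, 0; 0, κ] * twistJacobian 1 (κ ^ 2 * θ₀) (κ ^ 2 * θ₀') x y * !![κ, 0; 0, κ⁻¹] =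
      twistJacobian κ θ₀ θ₀' x y := by
  ext i j
  fin_cases i <;> fin_cases j <;> simp [twistJacobian] <;> field_simp

/-- In the limit `κ → 0` the conjugated Jacobian is a shear. -/
theorem twistJacobian_zero (θ₀ θ₀' x y : ℝ) :
    twistJacobian 0 θ₀ θ₀' x y = !![1, -θ₀ - 2 * θ₀' * y ^ 2; 0, 1] := by
  simp [twistJacobian]
  ring

theorem isCompact_disc : IsCompact {x : Fin 2 → ℝ | x 0 ^ 2 + x 1 ^ 2 ≤ 2} := by
  refine Metric.isCompact_of_isClosed_isBounded
    (isClosed_le (by fun_prop) continuous_const) (Metric.isBounded_closedBall (x := 0) (r := 2)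
      |>.subset fun x hx => ?_)
  simp only [mem_ofPred_eq] at hx
  rw [mem_closedBall_zero_iff, pi_norm_le_iff_of_nonneg (by norm_num)]
  intro i
  rw [Real.norm_eq_abs]
  refine abs_le_of_sq_le_sq ?_ (by norm_num)
  fin_cases i <;> simp <;> nlinarith [sq_nonneg (x 0), sq_nonneg (x 1)]

theorem twist_eq_self {h : ℝ → ℝ} (h0 : ∀ t, 2 ≤ t → h t = 0) {x : Fin 2 → ℝ}
    (hx : x ∉ {x : Fin 2 → ℝ | x 0 ^ 2 + x 1 ^ 2 ≤ 2}) : twist h x = x := by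
  simp only [mem_ofPred_eq, not_le] at hx
  ext i
  fin_cases i <;> simp [twist, h0 _ hx.le]

theorem twist_mem_localGroupC {h : ℝ → ℝ} (hh : ContDiff ℝ ∞ h) (h0 : ∀ t, 2 ≤ t → h t = 0) :
    twist h ∈ localGroupC (SL 2) :=
  mem_localGroupC_SL.2 ⟨contDiff_twist hh, fun x => by rw [grad_twist hh, det_twistJacobian],
    _, isCompact_disc, fun _ hx => twist_eq_self h0 hx⟩

/-- An angle function: equal to `c` on `r ≤ 1` and to `0` on `r ≥ 2`. -/
noncomputable def angle (c r : ℝ) : ℝ := c * Real.smoothTransition (2 - r)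

theorem contDiff_angle (c : ℝ) : ContDiff ℝ ∞ (angle c) :=
  contDiff_const.mul (Real.smoothTransition.contDiff.comp (contDiff_const.sub contDiff_id))

theorem angle_of_two_le (c r : ℝ) (hr : 2 ≤ r) : angle c r = 0 := by
  rw [angle, Real.smoothTransition.zero_of_nonpos (by linarith), mul_zero]

theorem angle_of_le_one (c r : ℝ) (hr : r ≤ 1) : angle c r = c := by
  rw [angle, Real.smoothTransition.one_of_one_le (by linarith), mul_one]

theorem mul_angle (k c r : ℝ) : k * angle c r = angle (k * c) r := by
  rw [angle, angle, mul_assoc]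

theorem mul_deriv_angle (k c r : ℝ) : k * deriv (angle c) r = deriv (angle (k * c)) r := by
  have : angle (k * c) = fun r => k * angle c r := funext fun r => (mul_angle k c r).symm
  rw [this, deriv_const_mul_field]

/-! ### Maps that are linear near a point -/

/-- The matrices `F` that are the differential near the origin of an element of `[SL₂]_c`
that is linear there. -/
def linearGerms : Set (Matrix (Fin 2) (Fin 2) ℝ) :=
  {F | ∃ φ ∈ localGroupC (SL 2), φ =ᶠ[𝓝 0] fun x => F *ᵥ x}

theorem mul_mem_linearGerms {F G : Matrix (Fin 2) (Fin 2) ℝ} (hF : F ∈ linearGerms)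
    (hG : G ∈ linearGerms) : F * G ∈ linearGerms := by
  obtain ⟨φ, hφ, h1⟩ := hF
  obtain ⟨ψ, hψ, h2⟩ := hG
  refine ⟨_, comp_mem_localGroupC hφ hψ, ?_⟩
  have ht : Tendsto ψ (𝓝 0) (𝓝 0) := by
    have h0 : ψ 0 = 0 := by simpa using h2.self_of_nhds
    simpa [h0] using (mem_localGroupC_SL.1 hψ).1.continuous.tendsto 0
  filter_upwards [ht.eventually h1, h2] with x hx1 hx2
  rw [hx1, hx2, mulVec_mulVec]

theorem conj_mem_linearGerms {F A B : Matrix (Fin 2) (Fin 2) ℝ} (hF : F ∈ linearGerms)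
    (hAB : A * B = 1) : A * F * B ∈ linearGerms := by
  obtain ⟨φ, hφ, h1⟩ := hF
  refine ⟨_, conj_mem_localGroupC hφ hAB, ?_⟩
  have ht : Tendsto (fun x : Fin 2 → ℝ => B *ᵥ x) (𝓝 0) (𝓝 0) := by
    simpa using (contDiff_mulVec B).continuous.tendsto 0
  filter_upwards [ht.eventually h1] with x hx
  rw [hx]
  simp only [mulVec_mulVec, mul_assoc]

/-- Quarter turns, rotated inside the unit disc only, are linear germs. -/
theorem quarterTurn_mem_linearGerms : !![0, -1; 1, 0] ∈ linearGerms := by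
  refine ⟨_, twist_mem_localGroupC (contDiff_angle (Real.pi / 2)) (angle_of_two_le _), ?_⟩
  have hc : Continuous fun x : Fin 2 → ℝ => x 0 ^ 2 + x 1 ^ 2 := by fun_prop
  filter_upwards [(hc.tendsto 0).eventually_le_const (u := 1) (by simp)] with x hx
  ext i
  fin_cases i <;> simp [twist, angle_of_le_one _ _ hx] <;> rfl

theorem shear_mem_linearGerms (s : ℝ) : !![1, s; 0, 1] ∈ linearGerms := by
  -- `diag(4, 1/4)` and `diag(1/4, 4)` are products of a conjugate of the quarter turn
  -- and its inverse, and every shear is a commutator of such a matrix with a shear.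
  have hJ3 := mul_mem_linearGerms quarterTurn_mem_linearGerms
    (mul_mem_linearGerms quarterTurn_mem_linearGerms quarterTurn_mem_linearGerms)
  have hD := mul_mem_linearGerms (conj_mem_linearGerms (A := !![2, 0; 0, 1 / 2])
    (B := !![1 / 2, 0; 0, 2]) quarterTurn_mem_linearGerms
      (by simp [one_fin_two])) hJ3
  have hD' := mul_mem_linearGerms (conj_mem_linearGerms (A := !![1 / 2, 0; 0, 2])
    (B := !![2, 0; 0, 1 / 2]) quarterTurn_mem_linearGerms
      (by simp [one_fin_two])) hJ3
  have h := mul_mem_linearGerms hD (conj_mem_linearGerms (A := !![1, s / 15; 0, 1])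
    (B := !![1, -(s / 15); 0, 1]) hD' (by simp [one_fin_two]))
  convert h using 1
  ext i j
  fin_cases i <;> fin_cases j <;> simp <;> ring

theorem mem_linearGerms {F : Matrix (Fin 2) (Fin 2) ℝ} (hF : F.det = 1) : F ∈ linearGerms := by
  have hL : ∀ s : ℝ, !![1, 0; s, 1] ∈ linearGerms := by
    intro s
    convert conj_mem_linearGerms (A := !![0, -1; 1, 0]) (B := !![0, 1; -1, 0])
      (shear_mem_linearGerms (-s)) (by simp [one_fin_two]) using 1
    ext i j
    fin_cases i <;> fin_cases j <;> simp
  have hc : ∀ G : Matrix (Fin 2) (Fin 2) ℝ, G.det = 1 → G 1 0 ≠ 0 → G ∈ linearGerms := by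
    intro G hG h0
    convert mul_mem_linearGerms (shear_mem_linearGerms ((G 0 0 - 1) / G 1 0))
      (mul_mem_linearGerms (hL (G 1 0)) (shear_mem_linearGerms ((G 1 1 - 1) / G 1 0))) using 1
    rw [det_fin_two] at hG
    ext i j
    fin_cases i <;> fin_cases j <;> simp <;> field_simp <;> linarith
  by_cases h0 : F 1 0 = 0
  · have hd : F 1 1 ≠ 0 := by
      intro h11
      simp [det_fin_two, h0, h11] at hF
    have h := mul_mem_linearGerms (hc (F * !![1, 0; 1, 1]) (by simp [det_mul, hF, det_fin_two])
      (by simp [Matrix.mul_apply, Fin.sum_univ_two, h0, hd])) (hL (-1))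
    rw [mul_assoc] at h
    simpa [Matrix.mul_fin_two, ← one_fin_two] using h
  · exact hc F hF h0

theorem mem_jetC {F : Matrix (Fin 2) (Fin 2) ℝ} (hF : F.det = 1) : F ∈ jetC (SL 2) := by
  obtain ⟨φ, hφ, h⟩ := mem_linearGerms hF
  exact ⟨φ, hφ, 0, by rw [grad_congr h, grad_mulVec]⟩

/-! ### A maximum principle on the line -/

/-- One half of the maximum principle: a continuous function whose averages against the small
multiples of `m` reproduce its values stays below its chords. -/
theorem le_chord_of_integral_comp_eq_zero {X : Type*} [TopologicalSpace X] [MeasurableSpace X]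
    [OpensMeasurableSpace X] {μ : Measure X} [μ.IsOpenPosMeasure] [IsFiniteMeasureOnCompacts μ]
    {m : X → ℝ} (hm : Continuous m) (hmc : HasCompactSupport m) (hm0 : ∫ x, m x ∂μ = 0)
    {x₀ : X} (hx₀ : m x₀ < 0) {u : ℝ → ℝ} (hu : Continuous u)
    (h : ∀ t s : ℝ, ∫ x, (u (t + s * m x) - u t) ∂μ = 0) {a b c : ℝ} (hac : a ≤ c)
    (hcb : c ≤ b) (hab : a < b) :
    u c ≤ u a + (c - a) * ((u b - u a) / (b - a)) := by
  set k := (u b - u a) / (b - a) with hk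
  set v : ℝ → ℝ := fun t => u t - (u a + (t - a) * k) with hv
  have hvc : Continuous v := by fun_prop
  have hva : v a = 0 := by simp [hv]
  have hvb : v b = 0 := by
    have : b - a ≠ 0 := by linarith
    simp only [hv, hk]; field_simp; ring
  have hcs : ∀ w : ℝ → ℝ, ∀ t s : ℝ, HasCompactSupport fun x => w (t + s * m x) - w t := by
    intro w t s
    exact hmc.comp_left (g := fun r => w (t + s * r) - w t) (by simp)
  have hvi : ∀ t s : ℝ, ∫ x, (v t - v (t + s * m x)) ∂μ = 0 := by
    intro t s
    have e : ∀ x, v t - v (t + s * m x) = s * k * m x - (u (t + s * m x) - u t) := by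
      intro x; simp only [hv]; ring
    simp_rw [e]
    rw [integral_sub, integral_const_mul, hm0, h, mul_zero, sub_zero]
    · exact (hm.integrable_of_hasCompactSupport hmc).const_mul _
    · exact Continuous.integrable_of_hasCompactSupport (by fun_prop) (hcs u t s)
  by_contra! hlt
  have hvcpos : 0 < v c := by simp only [hv]; linarith
  obtain ⟨t₁, ht₁, hmax⟩ := isCompact_Icc.exists_isMaxOn (nonempty_Icc.2 hab.le)
    (hvc.continuousOn (s := Icc a b))
  have hM : 0 < v t₁ := hvcpos.trans_le (hmax ⟨hac, hcb⟩)
  -- The leftmost maximum point: moving a little to the left decreases `v` strictly.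
  obtain ⟨t₀, ⟨ht₀, ht₀v⟩, hleast⟩ :=
    (isCompact_Icc.inter_right (isClosed_eq hvc (continuous_const (y := v t₁)))).exists_isLeast
      (s := Icc a b ∩ {t | v t = v t₁}) ⟨t₁, ht₁, rfl⟩
  simp only [mem_ofPred_eq] at ht₀v
  have ha : a < t₀ := lt_of_le_of_ne ht₀.1 fun h => by rw [← h, hva] at ht₀v; linarith
  have hb : t₀ < b := lt_of_le_of_ne ht₀.2 fun h => by rw [h, hvb] at ht₀v; linarith
  obtain ⟨C, hC⟩ := hmc.exists_bound_of_continuous hm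
  have hC0 : 0 < C := (abs_pos.2 hx₀.ne).trans_le (hC x₀)
  obtain ⟨s, hs, hsa, hsb⟩ : ∃ s > 0, s * C ≤ t₀ - a ∧ s * C ≤ b - t₀ := by
    refine ⟨min (t₀ - a) (b - t₀) / C, div_pos (lt_min (by linarith) (by linarith)) hC0, ?_, ?_⟩
    · rw [div_mul_cancel₀ _ hC0.ne']; exact min_le_left _ _
    · rw [div_mul_cancel₀ _ hC0.ne']; exact min_le_right _ _
  have hmem : ∀ x, t₀ + s * m x ∈ Icc a b := by
    intro x
    have h1 := abs_le.1 (hC x)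
    have h2 := mul_le_mul_of_nonneg_left h1.1 hs.le
    have h3 := mul_le_mul_of_nonneg_left h1.2 hs.le
    constructor <;> linarith
  have hcs' : HasCompactSupport fun x => v t₀ - v (t₀ + s * m x) :=
    hmc.comp_left (g := fun r => v t₀ - v (t₀ + s * r)) (by simp)
  refine (Continuous.integral_pos_of_hasCompactSupport_nonneg_nonzero (μ := μ) (x := x₀)
    (by fun_prop) hcs' (fun x => ?_) fun h0 => ?_).ne' (hvi t₀ s)
  · have : v (t₀ + s * m x) ≤ v t₁ := hmax (hmem x)
    simp only [Pi.zero_apply]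
    linarith
  · have := hleast ⟨hmem x₀, show v (t₀ + s * m x₀) = v t₁ by linarith⟩
    have := mul_neg_of_pos_of_neg hs hx₀
    linarith

/-- A continuous function on the line whose averages against all multiples of one nontrivial
compactly supported `m` of zero mean reproduce its values is affine. -/
theorem exists_affine_of_integral_comp_eq_zero {X : Type*} [TopologicalSpace X] [MeasurableSpace X]
    [OpensMeasurableSpace X] {μ : Measure X} [μ.IsOpenPosMeasure] [IsFiniteMeasureOnCompacts μ]
    {m : X → ℝ} (hm : Continuous m) (hmc : HasCompactSupport m) (hm0 : ∫ x, m x ∂μ = 0)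
    {x₀ : X} (hx₀ : m x₀ < 0) {u : ℝ → ℝ} (hu : Continuous u)
    (h : ∀ t s : ℝ, ∫ x, (u (t + s * m x) - u t) ∂μ = 0) :
    ∃ p q : ℝ, ∀ t, u t = p + t * q := by
  have hneg : ∀ t s : ℝ, ∫ x, (-u (t + s * m x) - -u t) ∂μ = 0 := by
    intro t s
    rw [← neg_eq_zero, ← integral_neg, ← h t s]
    congr 1
    ext x
    ring
  have chord : ∀ {a b c : ℝ}, a ≤ c → c ≤ b → a < b →
      (u c - u a) * (b - a) = (c - a) * (u b - u a) := by
    intro a b c hac hcb hab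
    have h1 := le_chord_of_integral_comp_eq_zero hm hmc hm0 hx₀ hu h hac hcb hab
    have h2 := le_chord_of_integral_comp_eq_zero hm hmc hm0 hx₀ hu.neg hneg hac hcb hab
    simp only [Pi.neg_apply] at h2
    have hba : b - a ≠ 0 := by linarith
    have e : -u a + (c - a) * ((-u b - -u a) / (b - a))
        = -(u a + (c - a) * ((u b - u a) / (b - a))) := by ring
    rw [e] at h2
    have h3 : u c = u a + (c - a) * ((u b - u a) / (b - a)) := by linarith
    rw [h3]
    field_simp
    ring
  refine ⟨u 0, u 1 - u 0, fun t => ?_⟩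
  rcases le_total t 0 with ht | ht
  · have := chord ht zero_le_one (ht.trans_lt one_pos)
    linarith
  rcases le_total t 1 with ht1 | ht1
  · have := chord ht ht1 one_pos
    linarith
  · have := chord zero_le_one ht1 (one_pos.trans_le ht1)
    linarith

/-! ### Functions on `SL₂` that are affine on lines -/

/-- A function on `SL₂` that is affine along all the lines `t ↦ P (1 + t e₁ ⊗ e₂) Q` contained in
the quadric `det = 1` is the restriction of an affine function. -/
theorem exists_affine_of_affine_on_lines {W : Matrix (Fin 2) (Fin 2) ℝ → ℝ}
    (hW : ∀ P Q : Matrix (Fin 2) (Fin 2) ℝ, P.det = 1 → Q.det = 1 →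
      ∃ p q : ℝ, ∀ t : ℝ, W (P * !![1, t; 0, 1] * Q) = p + t * q) :
    ∃ (a : Matrix (Fin 2) (Fin 2) ℝ) (b : ℝ), ∀ F : Matrix (Fin 2) (Fin 2) ℝ,
      F.det = 1 → W F = ∑ i, ∑ j, a i j * F i j + b := by
  set f : ℝ → ℝ → ℝ → ℝ := fun x y z => W !![1 + x * y, z * (1 + x * y) + x; y, y * z + 1] with hf
  have hx : ∀ y z, ∃ p q, ∀ x, f x y z = p + x * q := by
    intro y z
    obtain ⟨p, q, h⟩ := hW 1 !![1, z; y, y * z + 1] (by simp) (by simp [det_fin_two]; ring)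
    refine ⟨p, q, fun x => ?_⟩
    rw [← h x]
    simp only [hf]
    congr 1
    ext i j
    fin_cases i <;> fin_cases j <;> simp
    all_goals ring
  have hz : ∀ x y, ∃ p q, ∀ z, f x y z = p + z * q := by
    intro x y
    obtain ⟨p, q, h⟩ := hW !![1 + x * y, x; y, 1] 1 (by simp [det_fin_two]) (by simp)
    refine ⟨p, q, fun z => ?_⟩
    rw [← h z]
    simp only [hf]
    congr 1
    ext i j
    fin_cases i <;> fin_cases j <;> simp
    all_goals ring
  have hL : ∀ P Q : Matrix (Fin 2) (Fin 2) ℝ, P.det = 1 → Q.det = 1 →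
      ∃ p q : ℝ, ∀ t : ℝ, W (P * !![1, 0; t, 1] * Q) = p + t * q := by
    intro P Q hP hQ
    obtain ⟨p, q, h⟩ := hW (P * !![0, -1; 1, 0]) (!![0, 1; -1, 0] * Q)
      (by rw [det_mul, hP]; simp [det_fin_two]) (by rw [det_mul, hQ]; simp [det_fin_two])
    refine ⟨p, -q, fun t => ?_⟩
    have := h (-t)
    rw [← mul_assoc, mul_assoc P, mul_assoc P] at this
    simp only [Matrix.mul_fin_two] at this
    simp only [mul_one, mul_zero, zero_mul, mul_neg, neg_neg, neg_zero, zero_add, add_zero,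
      one_mul] at this
    rw [this]
    ring
  have hy : ∀ x z, ∃ p q, ∀ y, f x y z = p + y * q := by
    intro x z
    obtain ⟨p, q, h⟩ := hL !![1, x; 0, 1] !![1, z; 0, 1] (by simp [det_fin_two])
      (by simp [det_fin_two])
    refine ⟨p, q, fun y => ?_⟩
    rw [← h y]
    simp only [hf]
    congr 1
    ext i j
    fin_cases i <;> fin_cases j <;> simp
    all_goals ring
  have aff : ∀ {g : ℝ → ℝ}, (∃ p q, ∀ t, g t = p + t * q) →
      ∀ t, g t = g 0 + t * (g 1 - g 0) := by
    rintro g ⟨p, q, h⟩ t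
    rw [h t, h 0, h 1]
    ring
  have fx := fun y z => aff (hx y z)
  have fy := fun x z => aff (hy x z)
  have fz := fun x y => aff (hz x y)
  -- On `c = 0` the function depends on `x + z` only.
  have h0 : ∀ x z, f x 0 z = f (x + z) 0 0 := by
    intro x z
    simp only [hf]
    congr 2
    simp
    ring
  have h001 : f 0 0 1 = f 1 0 0 := by simpa using h0 0 1
  have h101 : f 1 0 1 = 2 * f 1 0 0 - f 0 0 0 := by
    rw [h0, fx 0 0 (1 + 1)]; ring
  -- The expansion of a function that is affine in each of three variables.
  have htri : ∀ x y z, f x y z = f 0 0 0 + x * (f 1 0 0 - f 0 0 0) + y * (f 0 1 0 - f 0 0 0)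
      + z * (f 0 0 1 - f 0 0 0) + x * y * (f 1 1 0 - f 1 0 0 - f 0 1 0 + f 0 0 0)
      + y * z * (f 0 1 1 - f 0 1 0 - f 0 0 1 + f 0 0 0)
      + x * z * (f 1 0 1 - f 1 0 0 - f 0 0 1 + f 0 0 0)
      + x * y * z * (f 1 1 1 - f 1 1 0 - f 0 1 1 - f 1 0 1 + f 1 0 0 + f 0 1 0 + f 0 0 1
        - f 0 0 0) := by
    intro x y z
    rw [fx y z x, fy 0 z y, fy 1 z y, fz 0 0 z, fz 0 1 z, fz 1 0 z, fz 1 1 z]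
    ring
  set e := f 0 0 0 with he
  set α := f 1 0 0 - e with hα
  set β := f 0 1 0 - e with hβ
  set δ := f 1 1 0 - f 1 0 0 - f 0 1 0 + e with hδ
  set η := f 0 1 1 - f 0 1 0 - f 0 0 1 + e with hη
  set k := f 1 1 1 - f 1 1 0 - f 0 1 1 - f 1 0 1 + f 1 0 0 + f 0 1 0 + f 0 0 1 - e - α with hk
  have hc : ∀ F : Matrix (Fin 2) (Fin 2) ℝ, F.det = 1 → F 1 0 ≠ 0 →
      W F = e + α * F 0 1 + β * F 1 0 + δ * (F 0 0 - 1) + η * (F 1 1 - 1)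
        + k * ((F 0 0 - 1) * (F 1 1 - 1) / F 1 0) := by
    intro F hF hc
    rw [det_fin_two] at hF
    have hb : F 0 1 = (F 0 0 * F 1 1 - 1) / F 1 0 := by field_simp; linarith
    have hFf : W F = f ((F 0 0 - 1) / F 1 0) (F 1 0) ((F 1 1 - 1) / F 1 0) := by
      simp only [hf]
      congr 1
      ext i j
      fin_cases i <;> fin_cases j <;> simp <;> [skip; rw [hb]; skip] <;> field_simp <;> ring
    rw [hFf]
    generalize F 0 0 = a at *
    generalize F 1 0 = c at *
    generalize F 1 1 = d at *
    rw [hb, htri, hk, hη, hδ, hβ, hα, h001, h101]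
    field_simp
    ring
  -- Along `diag(2, 1/2) L(t)` the last term of `hc` is `-k / t`, which is not affine in `t`.
  have hk0 : k = 0 := by
    obtain ⟨p, q, h⟩ := hL !![2, 0; 0, 1 / 2] 1 (by simp [det_fin_two]) (by simp)
    have h' : ∀ t : ℝ, t ≠ 0 → p + t * q = e + β * (t / 2) + δ - η / 2 - k / t := by
      intro t ht
      rw [← h t, hc _ (by simp [det_fin_two]) (by simp [ht])]
      simp
      field_simp
      ring
    have h1 := h' 1 (by norm_num)
    have h2 := h' 2 (by norm_num)
    have h3 := h' 3 (by norm_num)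
    linarith
  have hall : ∀ F : Matrix (Fin 2) (Fin 2) ℝ, F.det = 1 →
      W F = e + α * F 0 1 + β * F 1 0 + δ * (F 0 0 - 1) + η * (F 1 1 - 1) := by
    intro F hF
    by_cases hF0 : F 1 0 = 0
    · -- Extend from `c ≠ 0` along a line through `F` that leaves `c = 0`.
      obtain ⟨p, q, h⟩ := hL F 1 hF (by simp)
      have hd : F 1 1 ≠ 0 := by
        intro h11
        simp [det_fin_two, hF0, h11] at hF
      have h' : ∀ t : ℝ, t ≠ 0 → p + t * q = e + α * F 0 1 + β * (t * F 1 1)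
          + δ * (F 0 0 + t * F 0 1 - 1) + η * (F 1 1 - 1) := by
        intro t ht
        rw [← h t, hc _ (by simp [det_mul, hF, det_fin_two])
          (by simp [Matrix.mul_apply, Fin.sum_univ_two, hd, ht, hF0]), hk0]
        simp [Matrix.mul_apply, Fin.sum_univ_two, hF0]
        ring
      have h1 := h' 1 (by norm_num)
      have h2 := h' 2 (by norm_num)
      have h3 : W F = p := by
        have := h 0
        rwa [← Matrix.one_fin_two, mul_one, mul_one, zero_mul, add_zero] at this
      rw [h3, hF0]
      linarith
    · rw [hc F hF hF0, hk0]
      ring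
  refine ⟨!![δ, α; β, η], e - δ - η, fun F hF => ?_⟩
  rw [hall F hF]
  simp [Fin.sum_univ_two]
  ring

/-! ### Null functions and their invariance -/

/-- `W` is continuous on `SL₂`, and the integral over the whole plane of `W(∇φ)`, normalised by
subtracting the value for `φ = id`, vanishes for all `φ ∈ [SL₂]_c`. -/
def IsNull (W : Matrix (Fin 2) (Fin 2) ℝ → ℝ) : Prop :=
  ContinuousOn W {F | F.det = 1} ∧ ∀ φ ∈ localGroupC (SL 2), ∫ x, (W (grad φ x) - W 1) = 0

theorem continuous_comp_grad {W : Matrix (Fin 2) (Fin 2) ℝ → ℝ}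
    (hW : ContinuousOn W {F | F.det = 1}) {φ : (Fin 2 → ℝ) → (Fin 2 → ℝ)}
    (hφ : φ ∈ localGroupC (SL 2)) : Continuous fun x => W (grad φ x) := by
  obtain ⟨h1, h2, -⟩ := mem_localGroupC_SL.1 hφ
  exact hW.comp_continuous (continuous_grad h1) h2

theorem integrable_comp_grad_sub {W : Matrix (Fin 2) (Fin 2) ℝ → ℝ}
    (hW : ContinuousOn W {F | F.det = 1}) {φ : (Fin 2 → ℝ) → (Fin 2 → ℝ)}
    (hφ : φ ∈ localGroupC (SL 2)) : Integrable fun x => W (grad φ x) - W 1 := by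
  obtain ⟨-, -, K, hK, h⟩ := mem_localGroupC_SL.1 hφ
  refine ((continuous_comp_grad hW hφ).sub continuous_const).integrable_of_hasCompactSupport
    (HasCompactSupport.intro hK fun x hx => ?_)
  show W (grad φ x) - W 1 = 0
  rw [grad_eq_one_of_notMem hK h hx, sub_self]

open scoped Matrix.Norms.Elementwise in
theorem continuousOn_of_mem_Lambda0 {W : Matrix (Fin 2) (Fin 2) ℝ → ℝ}
    (hW : (fun _ F => W F) ∈ Lambda0 (SL 2)) : ContinuousOn W {F | F.det = 1} := by
  intro F hF
  obtain ⟨U, hU, hFU, g, hg, heq⟩ := hW (0, F) ⟨mem_univ _, mem_jetC hF⟩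
  have hgF : ContinuousAt g (0, F) := hg.continuousOn.continuousAt (hU.mem_nhds hFU)
  have hi : Continuous fun G : Matrix (Fin 2) (Fin 2) ℝ => ((0 : Fin 2 → ℝ), G) := by fun_prop
  have hc : ContinuousAt (fun G : Matrix (Fin 2) (Fin 2) ℝ => g (0, G)) F :=
    ContinuousAt.comp (f := fun G : Matrix (Fin 2) (Fin 2) ℝ => ((0 : Fin 2 → ℝ), G)) hgF
      hi.continuousAt
  have hev : ∀ᶠ G in 𝓝[{F | F.det = 1}] F, W G = g (0, G) := by
    filter_upwards [nhdsWithin_le_nhds (hi.continuousAt.preimage_mem_nhds (hU.mem_nhds hFU)),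
      self_mem_nhdsWithin] with G hG hG1
    exact heq ⟨hG, mem_univ _, mem_jetC hG1⟩
  exact hc.continuousWithinAt.congr_of_eventuallyEq hev (heq ⟨hFU, mem_univ _, mem_jetC hF⟩)

/-- Nullity on `Ω` gives nullity on the whole plane: a compactly supported deformation can be shrunk
homothetically into `Ω`. -/
theorem isNull_of_mem_homNullLagrangian {Ω : Set (Fin 2 → ℝ)} (hΩo : IsOpen Ω)
    (hΩb : Bornology.IsBounded Ω) (hΩn : Ω.Nonempty) {W : Matrix (Fin 2) (Fin 2) ℝ → ℝ}
    (hW : W ∈ HomNullLagrangian (SL 2) Ω) : IsNull W := by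
  obtain ⟨hW0, hW1⟩ := hW
  have hc := continuousOn_of_mem_Lambda0 hW0
  obtain ⟨c, hconst⟩ := hW1 _ ⟨0, 0, 1, one_pos, rfl⟩
  simp only [integralI] at hconst
  have hΩ : ∀ φ ∈ localGroupOn (SL 2) Ω, ∫ x, (W (grad φ x) - W 1) = 0 := by
    intro φ hφ
    obtain ⟨h1, h2, K, hK, hKΩ, h⟩ := mem_localGroupOn_SL.1 hφ
    have hφ' : φ ∈ localGroupC (SL 2) := mem_localGroupC_SL.2 ⟨h1, h2, K, hK, h⟩
    have hi := integrable_comp_grad_sub hc hφ'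
    have hconsti : IntegrableOn (fun _ : Fin 2 → ℝ => W 1) Ω :=
      integrableOn_const hΩb.measure_lt_top.ne
    rw [← setIntegral_eq_integral_of_forall_compl_eq_zero (s := Ω) fun x hx => by
      rw [grad_eq_one_of_notMem hK h fun hxK => hx (hKΩ hxK), sub_self]]
    have h3 : IntegrableOn (fun x => W (grad φ x)) Ω := by
      refine (hi.integrableOn.add hconsti).congr (ae_of_all _ fun x => ?_)
      simp
    have h4 := hconst _ (id_mem_localGroupOn Ω)
    simp only [grad_id] at h4
    rw [integral_sub h3 hconsti, hconst φ hφ, h4, sub_self]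
  refine ⟨hc, fun φ hφ => ?_⟩
  obtain ⟨h1, -, K, hK, h⟩ := mem_localGroupC_SL.1 hφ
  obtain ⟨x₀, hx₀⟩ := hΩn
  obtain ⟨δ, hδ, hball⟩ := Metric.isOpen_iff.1 hΩo x₀ hx₀
  obtain ⟨ε, hε, hεK⟩ := exists_pos_smul_norm_lt hK hδ
  have h5 := hΩ _ (rescale_mem_localGroupOn x₀ hε.ne' hφ hK h fun x hx => hball (by
    simpa [dist_eq_norm] using hεK x hx))
  simp only [grad_rescale x₀ hε.ne' h1] at h5
  rw [integral_sub_right_eq_self (fun x => W (grad φ (ε⁻¹ • x)) - W 1) x₀,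
    Measure.integral_comp_smul volume (fun x => W (grad φ x) - W 1) ε⁻¹, smul_eq_mul] at h5
  exact (mul_eq_zero.1 h5).resolve_left (by positivity)

theorem IsNull.conj {W : Matrix (Fin 2) (Fin 2) ℝ → ℝ} (hW : IsNull W)
    {A B : Matrix (Fin 2) (Fin 2) ℝ} (hA : A.det = 1) (hAB : A * B = 1) :
    IsNull fun G => W (A * G * B) := by
  have hB : B.det = 1 := by simpa [hA] using congrArg det hAB
  have hc : ContinuousOn (fun G => W (A * G * B)) {F | F.det = 1} :=
    hW.1.comp (by fun_prop) fun G hG => by simp_all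
  refine ⟨hc, fun φ hφ => ?_⟩
  have h1 := (mem_localGroupC_SL.1 hφ).1
  have h2 := hW.2 _ (conj_mem_localGroupC hφ hAB)
  simp only [grad_conj h1] at h2
  have hmap := Real.map_matrix_volume_pi_eq_smul_volume_pi (M := B) (by simp [hB])
  rw [hB, inv_one, abs_one, ENNReal.ofReal_one, one_smul] at hmap
  have hm : Continuous (toLin' B) := (contDiff_mulVec B).continuous
  have hg : Continuous fun x => W (A * grad φ x * B) - W (A * 1 * B) :=
    (continuous_comp_grad hc hφ).sub continuous_const
  rw [← hmap, integral_map hm.aemeasurable hg.aestronglyMeasurable, mul_one, hAB]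
  exact h2

/-- Null functions can be translated on the left: compose a small copy of `φ`, centred at the
origin, with an element of `[SL₂]_c` that is linear with differential `F` near the origin. -/
theorem IsNull.mul_left {W : Matrix (Fin 2) (Fin 2) ℝ → ℝ} (hW : IsNull W)
    {F : Matrix (Fin 2) (Fin 2) ℝ} (hF : F.det = 1) : IsNull fun G => W (F * G) := by
  have hc : ContinuousOn (fun G => W (F * G)) {F | F.det = 1} :=
    hW.1.comp (by fun_prop) fun G hG => by simp_all
  refine ⟨hc, fun φ hφ => ?_⟩
  obtain ⟨h1, h2, K, hK, h⟩ := mem_localGroupC_SL.1 hφ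
  obtain ⟨ψ, hψ, hψF⟩ := mem_linearGerms hF
  obtain ⟨δ, hδ, hball⟩ := Metric.mem_nhds_iff.1 hψF.eventuallyEq_nhds
  -- The scale `ε` keeps both the support of `φ - id` and its image where `ψ` is linear.
  obtain ⟨ε, hε, hεK⟩ := exists_pos_smul_norm_lt (hK.union (hK.image h1.continuous)) hδ
  set φ' := rescale 0 ε φ with hφ'
  have hmem : φ' ∈ localGroupC (SL 2) :=
    rescale_mem_localGroupOn 0 hε.ne' hφ hK h fun x _ => mem_univ _
  have hd : Differentiable ℝ φ' := (contDiff_rescale 0 ε h1).differentiable (by simp)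
  have hψd : Differentiable ℝ ψ := (mem_localGroupC_SL.1 hψ).1.differentiable (by simp)
  have hψg : ∀ y : Fin 2 → ℝ, ‖y‖ < δ → grad ψ y = F := by
    intro y hy
    have : ψ =ᶠ[𝓝 y] fun x => F *ᵥ x := hball (mem_ball_zero_iff.2 hy)
    rw [grad_congr this, grad_mulVec]
  -- Off the support of `φ' - id` both sides vanish; on it `∇ψ = F`, and the terms `W 1` cancel.
  have hpt : ∀ x, W (F * grad φ' x) - W F =
      (W (grad (fun y => ψ (φ' y)) x) - W 1) - (W (grad ψ x) - W 1) := by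
    intro x
    rw [grad_comp (hψd _) (hd _)]
    by_cases hx : ε⁻¹ • x ∈ K
    · have hx1 : ‖x‖ < δ := by
        have := hεK _ (Or.inl hx)
        rwa [smul_smul, mul_inv_cancel₀ hε.ne', one_smul] at this
      have hx2 : ‖φ' x‖ < δ := by
        simpa [hφ', rescale] using hεK _ (Or.inr ⟨_, hx, rfl⟩)
      rw [hψg _ hx1, hψg _ hx2]
      ring
    · have hg : grad φ' x = 1 := by
        rw [grad_rescale 0 hε.ne' h1, sub_zero, grad_eq_one_of_notMem hK h hx]
      have hx' : φ' x = x := by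
        simp only [hφ', rescale, sub_zero, zero_add]
        rw [h _ hx, smul_smul, mul_inv_cancel₀ hε.ne', one_smul]
      rw [hg, hx', mul_one, mul_one]
      ring
  have hcomp := comp_mem_localGroupC hψ hmem
  have h5 : ∫ x, (W (F * grad φ' x) - W F) = 0 := by
    simp_rw [hpt]
    rw [integral_sub (integrable_comp_grad_sub hW.1 hcomp) (integrable_comp_grad_sub hW.1 hψ),
      hW.2 _ hcomp, hW.2 _ hψ, sub_zero]
  simp only [hφ', grad_rescale 0 hε.ne' h1, sub_zero] at h5
  rw [Measure.integral_comp_smul volume (fun x => W (F * grad φ x) - W F) ε⁻¹, smul_eq_mul] at h5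
  simpa using (mul_eq_zero.1 h5).resolve_left (by positivity)

/-! ### Means over shears -/

/-- The partial derivative `∂₂X₁` of the vector field `X(x) = h(|x|²) (-x₂, x₁)`, `h = angle c`,
which generates the infinitesimal twist. -/
noncomputable def shearCoeff (c : ℝ) (x : Fin 2 → ℝ) : ℝ :=
  -angle c (x 0 ^ 2 + x 1 ^ 2) - 2 * deriv (angle c) (x 0 ^ 2 + x 1 ^ 2) * x 1 ^ 2

theorem shearCoeff_eq_mul (c : ℝ) (x : Fin 2 → ℝ) : shearCoeff c x = c * shearCoeff 1 x := by
  have h1 := mul_angle c 1 (x 0 ^ 2 + x 1 ^ 2)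
  have h2 := mul_deriv_angle c 1 (x 0 ^ 2 + x 1 ^ 2)
  rw [mul_one] at h1 h2
  rw [shearCoeff, shearCoeff, ← h1, ← h2]
  ring

theorem continuous_angle (c : ℝ) : Continuous (angle c) := (contDiff_angle c).continuous

theorem continuous_deriv_angle (c : ℝ) : Continuous (deriv (angle c)) :=
  (contDiff_angle c).continuous_deriv (by simp)

theorem continuous_shearCoeff (c : ℝ) : Continuous (shearCoeff c) := by
  have h1 := continuous_angle c
  have h2 := continuous_deriv_angle c
  unfold shearCoeff
  fun_prop

theorem deriv_angle_of_two_lt (c r : ℝ) (hr : 2 < r) : deriv (angle c) r = 0 := by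
  have : angle c =ᶠ[𝓝 r] fun _ => 0 := by
    filter_upwards [lt_mem_nhds hr] with t ht using angle_of_two_le c t ht.le
  rw [this.deriv_eq, deriv_const]

theorem hasCompactSupport_shearCoeff (c : ℝ) : HasCompactSupport (shearCoeff c) := by
  refine HasCompactSupport.intro isCompact_disc fun x hx => ?_
  simp only [mem_ofPred_eq, not_le] at hx
  simp [shearCoeff, angle_of_two_le c _ hx.le, deriv_angle_of_two_lt c _ hx]

theorem shearCoeff_zero_neg : shearCoeff 1 0 < 0 := by
  simp [shearCoeff, angle_of_le_one]

theorem integral_shearCoeff : ∫ x, shearCoeff 1 x = 0 := by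
  -- `shearCoeff 1` is the partial derivative `∂₂` of the compactly supported function `g`.
  set g : (Fin 2 → ℝ) → ℝ := fun x => -(angle 1 (x 0 ^ 2 + x 1 ^ 2) * x 1) with hg
  have hgc : Continuous g := by
    have := continuous_angle 1
    fun_prop
  have hgs : HasCompactSupport g := by
    refine HasCompactSupport.intro isCompact_disc fun x hx => ?_
    simp only [mem_ofPred_eq, not_le] at hx
    simp [hg, angle_of_two_le 1 _ hx.le]
  have hline : ∀ x, HasLineDerivAt ℝ g (shearCoeff 1 x) x (Pi.single 1 1) := by
    intro x
    have p : ∀ i : Fin 2, HasFDerivAt (fun x : Fin 2 → ℝ => x i)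
        (ContinuousLinearMap.proj (R := ℝ) (φ := fun _ : Fin 2 => ℝ) i) x :=
      fun i => hasFDerivAt_apply i x
    have hr := ((p 0).pow 2).add ((p 1).pow 2)
    have hθ := (((contDiff_angle 1).differentiable (by simp)
      (x 0 ^ 2 + x 1 ^ 2)).hasDerivAt).comp_hasFDerivAt x hr
    have h : HasLineDerivAt ℝ g _ x (Pi.single 1 1) :=
      ((hθ.mul (p 1)).neg).hasLineDerivAt (Pi.single 1 1)
    convert h using 1
    simp [shearCoeff]
    ring
  have hi : Integrable (shearCoeff 1) :=
    (continuous_shearCoeff 1).integrable_of_hasCompactSupport (hasCompactSupport_shearCoeff 1)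
  have h := integral_bilinear_hasLineDerivAt_right_eq_neg_left_of_integrable (μ := volume)
    (f := fun _ : Fin 2 → ℝ => (1 : ℝ)) (f' := fun _ => 0) (g := g) (g' := shearCoeff 1)
    (v := Pi.single 1 1) (B := ContinuousLinearMap.mul ℝ ℝ) (by simp)
    (by simpa using hi)
    (by simpa using hgc.integrable_of_hasCompactSupport hgs)
    (fun x _ => by simpa [HasLineDerivAt] using hasDerivAt_const (0 : ℝ) (1 : ℝ))
    (fun x _ => hline x)
  simpa using h

/-- Twists by an angle `κ² angle c`, stretched by `diag(κ⁻¹, κ)`, have Jacobians that tend to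
shears as `κ → 0`. Hence a null function has mean `W(1)` along the shears with coefficient
`shearCoeff c`. -/
theorem IsNull.integral_shear {W : Matrix (Fin 2) (Fin 2) ℝ → ℝ} (hW : IsNull W) (c : ℝ) :
    ∫ x, (W !![1, shearCoeff c x; 0, 1] - W 1) = 0 := by
  set J : ℝ → (Fin 2 → ℝ) → Matrix (Fin 2) (Fin 2) ℝ := fun κ x =>
    twistJacobian κ (angle c (x 0 ^ 2 + x 1 ^ 2)) (deriv (angle c) (x 0 ^ 2 + x 1 ^ 2)) (x 0) (x 1)
    with hJ
  set D := {x : Fin 2 → ℝ | x 0 ^ 2 + x 1 ^ 2 ≤ 2} with hD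
  have hJD : ∀ κ, ∀ x ∉ D, J κ x = 1 := by
    intro κ x hx
    simp only [hD, mem_ofPred_eq, not_le] at hx
    simp [hJ, angle_of_two_le c _ hx.le, deriv_angle_of_two_lt c _ hx, twistJacobian, one_fin_two]
  have hD0 : ∀ κ, ∫ x, (W (J κ x) - W 1) = ∫ x in D, (W (J κ x) - W 1) := fun κ =>
    (setIntegral_eq_integral_of_forall_compl_eq_zero fun x hx => by
      rw [hJD κ x hx, sub_self]).symm
  have hJc : Continuous (Function.uncurry J) := by
    have h1 := continuous_angle c
    have h2 := continuous_deriv_angle c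
    exact continuous_twistJacobian.comp (f := fun p : ℝ × (Fin 2 → ℝ) =>
      (p.1, angle c (p.2 0 ^ 2 + p.2 1 ^ 2), deriv (angle c) (p.2 0 ^ 2 + p.2 1 ^ 2), p.2 0, p.2 1))
      (by fun_prop)
  have hcont : Continuous fun κ => ∫ x in D, (W (J κ x) - W 1) := by
    refine continuous_parametric_integral_of_continuous ?_ isCompact_disc
    exact (hW.1.comp_continuous hJc fun p => det_twistJacobian _ _ _ _ _).sub continuous_const
  have hne : ∀ κ : ℝ, κ ≠ 0 → ∫ x in D, (W (J κ x) - W 1) = 0 := by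
    intro κ hκ
    rw [← hD0]
    have h := (hW.conj (A := !![κ⁻¹, 0; 0, κ]) (B := !![κ, 0; 0, κ⁻¹]) (by simp [det_fin_two, hκ])
      (by simp [one_fin_two, hκ])).2 _
      (twist_mem_localGroupC (contDiff_angle (κ ^ 2 * c)) (angle_of_two_le _))
    simp only [grad_twist (contDiff_angle (κ ^ 2 * c)), ← mul_angle, ← mul_deriv_angle,
      twistJacobian_conj hκ] at h
    simpa [one_fin_two, hκ] using h
  have h0 : ∫ x in D, (W (J 0 x) - W 1) = 0 := by
    have hcl : IsClosed {κ : ℝ | ∫ x in D, (W (J κ x) - W 1) = 0} :=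
      isClosed_eq hcont continuous_const
    exact hcl.closure_subset_iff.2 (fun κ hκ => hne κ hκ) (dense_compl_singleton (0 : ℝ) 0)
  rw [← hD0] at h0
  simpa only [hJ, twistJacobian_zero, shearCoeff] using h0

theorem IsNull.affine_on_lines {W : Matrix (Fin 2) (Fin 2) ℝ → ℝ} (hW : IsNull W)
    {P Q : Matrix (Fin 2) (Fin 2) ℝ} (hP : P.det = 1) (hQ : Q.det = 1) :
    ∃ p q : ℝ, ∀ t : ℝ, W (P * !![1, t; 0, 1] * Q) = p + t * q := by
  have hshear : ∀ t : ℝ, (!![1, t; 0, 1] : Matrix (Fin 2) (Fin 2) ℝ).det = 1 := by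
    simp [det_fin_two]
  -- `P G Q = (P Q) (Q⁻¹ G Q)`, a conjugation followed by a left translation.
  have hPQ : IsNull fun G => W (P * G * Q) := by
    have hi : Q⁻¹ * Q = 1 := nonsing_inv_mul _ (by simp [hQ])
    have h := (hW.mul_left (F := P * Q) (by simp [hP, hQ])).conj (A := Q⁻¹) (B := Q)
      (by simp [hQ, det_nonsing_inv]) hi
    convert h using 3 with G
    rw [mul_assoc P Q, ← mul_assoc Q, ← mul_assoc Q, mul_nonsing_inv _ (by simp [hQ]), one_mul,
      mul_assoc]
  refine exists_affine_of_integral_comp_eq_zero (continuous_shearCoeff 1)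
    (hasCompactSupport_shearCoeff 1) integral_shearCoeff shearCoeff_zero_neg
    (u := fun t => W (P * !![1, t; 0, 1] * Q)) ?_ fun t s => ?_
  · refine hPQ.1.comp_continuous (continuous_matrix fun i j => ?_) hshear
    fin_cases i <;> fin_cases j <;> simp <;> fun_prop
  · have h := (hPQ.mul_left (hshear t)).integral_shear s
    simp only [mul_one] at h
    refine Eq.trans (integral_congr_ae (ae_of_all _ fun x => ?_)) h
    beta_reduce
    rw [shearCoeff_eq_mul s x]
    congr 4
    simp [add_comm]

end DiffeoGroup

theorem theorem5p3 (Ω : Set (Fin 2 → ℝ)) (hΩo : IsOpen Ω) (hΩb : Bornology.IsBounded Ω)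
    (hΩn : Ω.Nonempty) (W : Matrix (Fin 2) (Fin 2) ℝ → ℝ)
    (hW : W ∈ DiffeoGroup.HomNullLagrangian (DiffeoGroup.SL 2) Ω) :
    ∃ (a : Matrix (Fin 2) (Fin 2) ℝ) (b : ℝ), ∀ F : Matrix (Fin 2) (Fin 2) ℝ,
      F ∈ DiffeoGroup.carrier (DiffeoGroup.SL 2) → W F = ∑ i, ∑ j, a i j * F i j + b := by
  have hN := DiffeoGroup.isNull_of_mem_homNullLagrangian hΩo hΩb hΩn hW
  obtain ⟨a, b, h⟩ := DiffeoGroup.exists_affine_of_affine_on_lines fun P Q hP hQ =>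
    hN.affine_on_lines hP hQ
  exact ⟨a, b, fun F hF => h F ((DiffeoGroup.mem_carrier_SL F).1 hF)⟩
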